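/- A graph consists of a vertex set $V$, an edge set $E$, maps $\alpha,\omega:E\to V$ (source and target) and a map $e\mapsto\overline e$ from $E$ to $E$ with $\overline{\overline e}=e$ and $\alpha(\overline e)=\omega(e)$; edges with $\overline e=e$ are allowed. A circuit is a vertex $v_0$ together with a sequence of edges $(e_1,\dots,e_\ell)$, $\ell\ge 0$, that forms a path from $v_0$ to $v_0$; its length is $|\pi|=\ell$ and its cyclic bump count is $\mathrm{cbc}(\pi)=\#\{1\le i\le \ell : e_i=\overline{e_{i+1}}\}$, where $e_{\ell+1}=e_1$. A cycle is a class of circuits under cyclic permutation of the edges; it is primitive if none of its representatives is of the form $\pi^k$ with $\pi$ a circuit and $k\ge2$ (in particular a circuit of length $0$, being its own square, does not represent a primitive cycle). Let $V$ and $E$ be finite and define integer matrices: $B,J$ indexed by $E\times E$ with $B_{e,f}=1$ if $\omega(e)=\alpha(f)$ and $0$ otherwise, $J_{e,f}=1$ if $\overline e=f$ and $0$ otherwise; $A,D$ indexed by $V\times V$ with $A_{v,w}=\#\{e:\alpha(e)=v,\ \omega(e)=w\}$ and $D$ diagonal with $D_{v,v}=\#\{e:\alpha(e)=v\}$. Put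 $$M=I-(B-(1-u)J)t,\qquad P=I-At+(1-u)\bigl(D-(1-u)I\bigr)t^2,$$ $n=\#\{e\in E: e=\overline e\}$ and $2m=\#\{e\in E: e\ne\overline e\}$. **Theorem.** Let $\mathcal C$ be a set containing exactly one representative of each primitive cycle and no other circuit. Then the product $$\zeta(u,t)=\prod_{\gamma\in\mathcal C}\frac1{1-u^{\mathrm{cbc}(\gamma)}t^{|\gamma|}}$$ converges in $\mathbb Z[u][[t]]$ (coefficientwise in $t$, with $\mathbb Z[u]$ discrete), does not depend on the choice of $\mathcal C$, and is invertible; $\zeta^{-1}$ is a polynomial in $u$ and $t$, the number $\#\{e:e\neq\overline e\}$ is even, and $$\frac1{\zeta(u,t)}=\det M=(1+(1-u)t)^{n}\,\bigl(1-(1-u)^2t^2\bigr)^{m-|V|}\det P ,$$ where a negative power of $1-(1-u)^2t^2$ is taken in the unit group of $\mathbb Z[u][[t]]$. -/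

import Mathlib

open Polynomial PowerSeries
open scoped PowerSeries.WithPiTopology

/-- A graph with vertex set `V` and edge set `E`: every edge has a source, a target and an inverse
edge. Loops, multiple edges and edges equal to their own inverse are allowed. -/
structure InvGraph (V E : Type*) where
  src : E → V
  tgt : E → V
  inv : E → E
  inv_inv : ∀ e, inv (inv e) = e
  src_inv : ∀ e, src (inv e) = tgt e

namespace InvGraph

variable {V E : Type*} (G : InvGraph V E)

/-- `G.IsPath x l y`: the sequence of edges `l` is a path from `x` to `y`. -/
def IsPath : V → List E → V → Prop
  | x, [], y => x = y
  | x, e :: l, y => G.src e = x ∧ IsPath (G.tgt e) l y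

theorem IsPath.append {x y z : V} {l m : List E} (h : G.IsPath x l y) (h' : G.IsPath y m z) :
    G.IsPath x (l ++ m) z := by
  induction l generalizing x with
  | nil => cases h; exact h'
  | cons e l ih => exact ⟨h.1, ih h.2⟩

/-- A circuit: a path that ends where it starts. Circuits of length `0` are given by their
base vertex. -/
structure Circuit where
  base : V
  edges : List E
  isPath : G.IsPath base edges base

namespace Circuit

variable {G}

/-- The number of edges of a circuit. -/
def length (c : G.Circuit) : ℕ := c.edges.length

/-- The `k`-fold concatenation of a circuit with itself. -/
def pow (c : G.Circuit) (k : ℕ) : G.Circuit where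
  base := c.base
  edges := (List.replicate k c.edges).flatten
  isPath := by
    induction k with
    | zero => exact rfl
    | succ k ih => exact IsPath.append G c.isPath ih

/-- Indices are taken modulo the length, so the edge after the last one is the first one. -/
def cyclicBumpCount [DecidableEq E] (c : G.Circuit) : ℕ :=
  (Finset.univ.filter fun i : Fin c.edges.length =>
    c.edges.get i = G.inv (c.edges.get
      ⟨(i.val + 1) % c.edges.length, Nat.mod_lt _ (Nat.zero_lt_of_lt i.isLt)⟩)).card

end Circuit

/-- Two circuits are equivalent if their edge sequences are cyclic permutations of each other
(the base vertex is determined by the edges, except for circuits of length `0`). -/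
def circuitSetoid : Setoid G.Circuit where
  r c d := c.edges ~r d.edges ∧ (c.edges = [] → c.base = d.base)
  iseqv :=
    { refl := fun c => ⟨List.IsRotated.refl _, fun _ => rfl⟩
      symm := fun {c d} h => ⟨h.1.symm, fun hd =>
        (h.2 (by have h1 := h.1; rw [hd] at h1; exact List.isRotated_nil_iff.mp h1)).symm⟩
      trans := fun {c d e} h h' => ⟨h.1.trans h'.1, fun hc =>
        (h.2 hc).trans (h'.2 (by
          have h1 := h.1; rw [hc] at h1; exact (List.isRotated_nil_iff'.mp h1).symm))⟩ }

/-- A cycle: a class of circuits under cyclic permutation. -/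
def Cycle : Type _ := Quotient G.circuitSetoid

/-- The cycle represented by a circuit. -/
def toCycle (c : G.Circuit) : G.Cycle := Quotient.mk G.circuitSetoid c

variable {G} in
/-- No representative is a proper power of a circuit. A circuit of length `0` is its own square,
so the cycle it represents is not primitive. -/
def Cycle.IsPrimitive (γ : G.Cycle) : Prop :=
  ∀ c : G.Circuit, G.toCycle c = γ → ¬ ∃ (p : G.Circuit) (k : ℕ), 2 ≤ k ∧ c = p.pow k

/-- `C` contains exactly one representative of every primitive cycle, and nothing else. -/
def IsPrimitiveRepresentatives (C : Set G.Circuit) : Prop :=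
  Set.BijOn G.toCycle C {γ | γ.IsPrimitive}

section Zeta

/-- The coefficient ring `ℤ[u]` is discrete, so that a family in `ℤ[u]⟦t⟧` converges if and only if
each coefficient of a power of `t` is eventually constant. -/
instance polyTopology : TopologicalSpace ℤ[X] := ⊥

instance polyDiscrete : DiscreteTopology ℤ[X] := ⟨rfl⟩

/-- The variable `u` of `ℤ[u]⟦t⟧`. -/
noncomputable def uS : ℤ[X]⟦X⟧ := PowerSeries.C Polynomial.X

/-- The variable `t` of `ℤ[u]⟦t⟧`. -/
noncomputable def tS : ℤ[X]⟦X⟧ := PowerSeries.X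

variable {G} in
/-- The factor `1 / (1 - u ^ cbc(c) t ^ |c|)` of the zeta function. -/
noncomputable def zetaFactor [DecidableEq E] (c : G.Circuit) : ℤ[X]⟦X⟧ :=
  Ring.inverse (1 - uS ^ c.cyclicBumpCount * tS ^ c.length)

/-- The product of the factors over a set `C` of circuits. -/
noncomputable def zeta [DecidableEq E] (C : Set G.Circuit) : ℤ[X]⟦X⟧ :=
  ∏' c : C, zetaFactor c.val

theorem isUnit_one_sub_sq : IsUnit (1 - (1 - uS) ^ 2 * tS ^ 2) := by
  rw [PowerSeries.isUnit_iff_constantCoeff]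
  simp [tS]

/-- The power series `1 - (1 - u)² t²` as a unit, so that it has powers with negative exponents. -/
noncomputable def oneSubSqUnit : ℤ[X]⟦X⟧ˣ := isUnit_one_sub_sq.unit

end Zeta

section Matrices

/-- The edge-adjacency matrix. -/
def edgeAdj [DecidableEq V] : Matrix E E ℤ :=
  Matrix.of fun e f => if G.tgt e = G.src f then 1 else 0

/-- The inversion matrix. -/
def inversion [DecidableEq E] : Matrix E E ℤ :=
  Matrix.of fun e f => if G.inv e = f then 1 else 0

/-- The vertex-adjacency matrix, counting edges from `v` to `w`. -/
def vertexAdj [Fintype E] [DecidableEq V] : Matrix V V ℤ :=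
  Matrix.of fun v w => ((Finset.univ.filter fun e => G.src e = v ∧ G.tgt e = w).card : ℤ)

/-- The number of edges with source `v`. -/
def degree [Fintype E] [DecidableEq V] (v : V) : ℕ :=
  (Finset.univ.filter fun e => G.src e = v).card

/-- The degree matrix. -/
def degreeMatrix [Fintype E] [DecidableEq V] : Matrix V V ℤ :=
  Matrix.diagonal fun v => (G.degree v : ℤ)

/-- The variable `u` of `ℤ[u][t]`. -/
noncomputable def uP : ℤ[X][X] := Polynomial.C Polynomial.X

/-- The variable `t` of `ℤ[u][t]`. -/
noncomputable def tP : ℤ[X][X] := Polynomial.X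

/-- An integer matrix viewed over `ℤ[u][t]`. -/
noncomputable def overPoly {ι κ : Type*} (N : Matrix ι κ ℤ) : Matrix ι κ ℤ[X][X] :=
  N.map (Int.castRingHom ℤ[X][X])

/-- `M = I - (B - (1 - u) J) t`. -/
noncomputable def matM [DecidableEq V] [DecidableEq E] : Matrix E E ℤ[X][X] :=
  1 - tP • (overPoly G.edgeAdj - (1 - uP) • overPoly G.inversion)

/-- `P = I - A t + (1 - u) (D - (1 - u) I) t²`. -/
noncomputable def matP [Fintype E] [DecidableEq V] : Matrix V V ℤ[X][X] :=
  1 - tP • overPoly G.vertexAdj +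
    ((1 - uP) * tP ^ 2) • (overPoly G.degreeMatrix - (1 - uP) • (1 : Matrix V V ℤ[X][X]))

/-- The number of edges that are their own inverse. -/
def numSelfInverse [Fintype E] [DecidableEq E] : ℕ :=
  (Finset.univ.filter fun e => e = G.inv e).card

/-- The number of edges that are not their own inverse. -/
def numNonSelfInverse [Fintype E] [DecidableEq E] : ℕ :=
  (Finset.univ.filter fun e => e ≠ G.inv e).card

end Matrices

end InvGraph

/-! Write `M = I - tW` with W = B - (1-u)J. For composable edges e, f the entry of W is u if the
step is a bump and 1 otherwise; for non-composable edges it is 0. The product of the entries of W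
once around a circuit c is therefore u^cbc(c), and tr(W^n) is the sum of these weights over the
closed walks of length n with a marked start.

Cutting a periodic walk after its minimal period gives a primitive circuit. So each n-periodic walk
is a shift, by a unique i < |c|, of the sequence of a unique chosen c with |c| dividing n, and
tr(W^n) = Σ |c| u^(cbc(c)·n/|c|) over these c (`trace_pow_bumpMatrix`). This is the n-th coefficient
of -t d/dt log of the product of the 1 - u^cbc(c) t^|c|, while Jacobi's formula shows that -t d/dt
log det(I - tW) = Σ tr(W^n) t^n. As ℤ[u] is torsion-free and both series start with 1, they agree.
The comparison is made up to a degree N with finite products (`coeff_prod_eq`), which also gives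
convergence (`hasProd_zetaFactor`).

For the second formula, B = TS for the target and source incidence matrices, so with s = (1-u)t one
has M = (I + sJ) - tTS. Since (I + sJ)(I - sJ) = (1 - s²)I, the identity det(I - XY) = det(I - YX)
turns det M into det(I + sJ) times a determinant over V. Because ST = A and SJT = D, the matrix over
V is P up to a power of 1 - s². The factor det(I + sJ) is read off from the orbits of the inversion
(`exists_coe_det_matM`). -/

/-! ### Determinants of perturbations of an involution matrix -/

section Involution

variable {ι : Type*} [Fintype ι]

/-- A finite set with an involution is the disjoint union of the fixed points and of two copies
of a set that contains one element of each orbit of size two. -/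
theorem Function.Involutive.exists_equiv {f : ι → ι} (hf : Function.Involutive f) :
    ∃ (H : Finset ι) (φ : {e // e = f e} ⊕ (H ⊕ H) ≃ ι),
      (∀ e, φ (.inl e) = e) ∧ (∀ h, φ (.inr (.inl h)) = h) ∧ (∀ h, φ (.inr (.inr h)) = f h) := by
  classical
  -- An arbitrary order serves only to select the smaller element of each two-element orbit.
  let : LinearOrder ι := LinearOrder.lift' (Fintype.equivFin ι) (Fintype.equivFin ι).injective
  let H : Finset ι := Finset.univ.filter fun e => e < f e
  have hH : ∀ h : H, h.1 < f h.1 := fun h => (Finset.mem_filter.mp h.2).2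
  let g : {e // e = f e} ⊕ (H ⊕ H) → ι :=
    Sum.elim (fun e => e.1) (Sum.elim (fun h => h.1) fun h => f h.1)
  have hg : Function.Bijective g := by
    constructor
    · rintro (⟨a, ha⟩ | a | a) (⟨b, hb⟩ | b | b) h <;> simp only [g, Sum.elim_inl, Sum.elim_inr] at h
      · simp [h]
      · subst h; exact absurd ha (hH b).ne
      · have := hH b; rw [← h] at this
        have h2 : f a = b := by rw [h, hf]
        rw [← ha] at h2; exact absurd h2 this.ne'
      · subst h; exact absurd hb (hH a).ne
      · rw [Subtype.ext h]
      · have h1 := hH a; have h2 := hH b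
        rw [h, hf] at h1; exact absurd h1 h2.asymm
      · have := hH a; rw [h] at this
        have h2 : f b = a := by rw [← h, hf]
        rw [← hb] at h2; exact absurd h2 this.ne'
      · have h1 := hH a; have h2 := hH b
        rw [← h, hf] at h2; exact absurd h1 h2.asymm
      · rw [Subtype.ext (hf.injective h)]
    · intro e
      rcases lt_trichotomy e (f e) with h | h | h
      · exact ⟨.inr (.inl ⟨e, by simpa [H] using h⟩), rfl⟩
      · exact ⟨.inl ⟨e, h⟩, rfl⟩
      · exact ⟨.inr (.inr ⟨f e, by simpa [H, hf e] using h⟩), hf e⟩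
  exact ⟨H, Equiv.ofBijective g hg, fun _ => rfl, fun _ => rfl, fun _ => rfl⟩

variable [DecidableEq ι]

/-- The determinant of `1 + s J` for the permutation matrix `J` of an involution. -/
theorem Function.Involutive.exists_det {R : Type*} [CommRing R] {f : ι → ι}
    (hf : Function.Involutive f) : ∃ m : ℕ, 2 * m = (Finset.univ.filter fun e => e ≠ f e).card ∧
      ∀ s : R, (1 + s • Matrix.of fun e e' => if f e = e' then (1 : R) else 0).det =
        (1 + s) ^ (Finset.univ.filter fun e => e = f e).card * (1 - s ^ 2) ^ m := by
  obtain ⟨H, φ, h1, h2, h3⟩ := hf.exists_equiv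
  have hcard : Fintype.card {e // e = f e} = (Finset.univ.filter fun e => e = f e).card :=
    Fintype.card_subtype _
  refine ⟨H.card, ?_, fun s => ?_⟩
  · have h := Fintype.card_congr φ
    simp only [Fintype.card_sum, Fintype.card_coe, hcard] at h
    have h' := Finset.card_filter_add_card_filter_not (s := Finset.univ) (fun e => e = f e)
    rw [Finset.card_univ] at h'
    simp only [ne_eq]
    lia
  · have hne : ∀ (e : {e // e = f e}) (h : H), e.1 ≠ h.1 := fun e h he => by
      have := φ.injective ((h1 e).trans (he.trans (h2 h).symm)); simp at this
    have hnf : ∀ (e : {e // e = f e}) (h : H), e.1 ≠ f h.1 := fun e h he => by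
      have := φ.injective ((h1 e).trans (he.trans (h3 h).symm)); simp at this
    have hHf : ∀ h h' : H, h.1 ≠ f h'.1 := fun h h' he => by
      have := φ.injective ((h2 h).trans (he.trans (h3 h').symm)); simp at this
    rw [← Matrix.det_submatrix_equiv_self φ]
    -- Each fixed point contributes 1 + s, and each two-element orbit the block with rows (1, s),
    -- (s, 1) of determinant 1 - s².
    have : (1 + s • Matrix.of fun e e' => if f e = e' then (1 : R) else 0).submatrix φ φ =
        Matrix.fromBlocks ((1 + s) • (1 : Matrix {e // e = f e} {e // e = f e} R)) 0 0
          (Matrix.fromBlocks 1 (s • (1 : Matrix H H R)) (s • (1 : Matrix H H R)) 1) := by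
      have key : ∀ i j, (1 + s • Matrix.of fun e e' => if f e = e' then (1 : R) else 0) i j =
          (if i = j then 1 else 0) + if f i = j then s else 0 := fun i j => by
        simp [Matrix.one_apply]
      ext i j
      rw [Matrix.submatrix_apply, key]
      rcases i with a | a | a <;> rcases j with b | b | b <;>
        simp only [h1, h2, h3, Matrix.fromBlocks_apply₁₁, Matrix.fromBlocks_apply₁₂,
          Matrix.fromBlocks_apply₂₁, Matrix.fromBlocks_apply₂₂, Matrix.zero_apply,
          Matrix.smul_apply, Matrix.one_apply, hf _, hf.injective.eq_iff, Subtype.ext_iff,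
          smul_eq_mul]
      · rw [← a.2]; split_ifs <;> simp
      · rw [← a.2, if_neg (hne a b), if_neg (hne a b), add_zero]
      · rw [if_neg (hnf a b), if_neg (hne a b), add_zero]
      · rw [if_neg (hne b a).symm, if_neg (hnf b a).symm, add_zero]
      · rw [if_neg (hHf b a).symm, add_zero]
      · rw [if_neg (hHf a b)]; simp
      · rw [if_neg (hnf b a).symm, if_neg (hne b a).symm, add_zero]
      · rw [if_neg (hHf b a).symm]; simp
      · rw [if_neg (hHf a b), add_zero]
    rw [this, Matrix.det_fromBlocks_zero₁₂, Matrix.det_smul, Matrix.det_one, mul_one,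
      Matrix.det_fromBlocks_one₁₁, hcard, Matrix.smul_mul, Matrix.one_mul, smul_smul, ← pow_two]
    have h6 : (1 : Matrix H H R) - s ^ 2 • 1 = (1 - s ^ 2) • 1 := by rw [sub_smul, one_smul]
    rw [h6, Matrix.det_smul, Matrix.det_one, mul_one, Fintype.card_coe]

/-- The determinant of a perturbation `K - T S` of a matrix `K` that is invertible up to a unit
scalar. -/
theorem Matrix.det_sub_mul_of_mul_eq_smul {κ R : Type*} [Fintype κ] [DecidableEq κ] [CommRing R]
    {K L : Matrix ι ι R} {d : R} (hd : IsUnit d) (h : K * L = d • 1)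
    (T : Matrix ι κ R) (S : Matrix κ ι R) :
    (K - T * S).det * d ^ Fintype.card κ = K.det * (d • 1 - S * L * T).det := by
  obtain ⟨d, rfl⟩ := hd
  have h1 : K - T * S = K * (1 - ((↑d⁻¹ : R) • (L * T)) * S) := by
    rw [Matrix.mul_sub, Matrix.mul_one, Matrix.smul_mul, Matrix.mul_smul, ← Matrix.mul_assoc,
      ← Matrix.mul_assoc, h, Matrix.smul_mul, Matrix.smul_mul, smul_smul]
    simp
  have h2 : ((d : R) • 1 - S * L * T) = (d : R) • (1 - S * ((↑d⁻¹ : R) • (L * T))) := by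
    rw [smul_sub, Matrix.mul_smul, smul_smul, Matrix.mul_assoc]
    simp
  rw [h1, h2, Matrix.det_mul, Matrix.det_one_sub_mul_comm, Matrix.det_smul]
  ring

end Involution

/-! ### The logarithmic derivative of `det (1 - t W)` -/

section LogDerivative

variable {ι R : Type*} [CommRing R]

theorem Derivation.leibniz_finset_prod {S A : Type*} [CommSemiring S] [CommSemiring A] [Algebra S A]
    [DecidableEq ι] (D : Derivation S A A) (s : Finset ι) (f : ι → A) :
    D (∏ i ∈ s, f i) = ∑ i ∈ s, (∏ j ∈ s.erase i, f j) * D (f i) := by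
  induction s using Finset.induction_on with
  | empty => simp
  | insert a s ha ih =>
    rw [Finset.prod_insert ha, D.leibniz, ih, Finset.sum_insert ha, Finset.erase_insert ha,
      smul_eq_mul, smul_eq_mul, Finset.mul_sum, add_comm]
    congr 1
    refine Finset.sum_congr rfl fun i hi => ?_
    have : a ≠ i := fun h => ha (h ▸ hi)
    rw [Finset.erase_insert_of_ne this, Finset.prod_insert (by simp [ha]), mul_assoc]

/-- **Jacobi's formula** for a derivation of the coefficient ring. -/
theorem Derivation.det_eq_trace {S A : Type*} [CommSemiring S] [CommRing A] [Algebra S A]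
    [Fintype ι] [DecidableEq ι] (D : Derivation S A A) (M : Matrix ι ι A) :
    D M.det = (M.adjugate * M.map D).trace := by
  -- Cramer's rule: the diagonal entry is the determinant with only column i differentiated. The sum
  -- over i is the Leibniz rule for each term of the expansion.
  have h : ∀ i, (M.adjugate * M.map D) i i = (M.updateCol i fun j => D (M j i)).det := by
    intro i
    rw [← Matrix.cramer_apply, Matrix.cramer_eq_adjugate_mulVec]
    rfl
  rw [Matrix.trace]
  simp only [Matrix.diag, h]
  simp only [Matrix.det_apply]
  rw [map_sum, Finset.sum_comm]
  refine Finset.sum_congr rfl fun σ _ => ?_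
  rw [← Finset.smul_sum, Units.smul_def, Units.smul_def, map_zsmul, D.leibniz_finset_prod]
  congr 1
  refine Finset.sum_congr rfl fun i _ => ?_
  rw [← Finset.mul_prod_erase _ _ (Finset.mem_univ i), mul_comm]
  congr 1
  · simp
  · refine Finset.prod_congr rfl fun j hj => ?_
    rw [Matrix.updateCol_ne (Finset.ne_of_mem_erase hj)]

/-- The generating function of the traces of the positive powers of a matrix. -/
noncomputable def Matrix.traceSeries [Fintype ι] [DecidableEq ι] (W : Matrix ι ι R) : R⟦X⟧ :=
  PowerSeries.mk fun n => if n = 0 then 0 else (W ^ n).trace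

/-- `1 - t W` as a matrix of power series. -/
noncomputable def Matrix.oneSubX [DecidableEq ι] (W : Matrix ι ι R) :
    Matrix ι ι R⟦X⟧ :=
  1 - (PowerSeries.X : R⟦X⟧) • W.map (PowerSeries.C (R := R))

/-- The inverse of 1 - tW is the geometric series Σ W^n t^n, so the adjugate in Jacobi's formula is
the determinant times this series. -/
theorem Matrix.X_mul_derivative_det_oneSubX [Fintype ι] [DecidableEq ι] (W : Matrix ι ι R) :
    PowerSeries.X * d⁄dX R W.oneSubX.det = -(W.oneSubX.det * W.traceSeries) := by
  let P : Matrix ι ι R⟦X⟧ := Matrix.of fun i j => PowerSeries.mk fun n => (W ^ n) i j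
  have hP : W.oneSubX * P = 1 := by
    ext i j n
    rw [Matrix.oneSubX, Matrix.sub_mul, Matrix.one_mul, Matrix.smul_mul]
    rw [Matrix.sub_apply, Matrix.smul_apply, Matrix.mul_apply, smul_eq_mul, map_sub]
    cases n with
    | zero =>
      simp [P, Matrix.one_apply]
    | succ n =>
      rw [PowerSeries.coeff_succ_X_mul, map_sum]
      simp only [Matrix.map_apply, PowerSeries.coeff_C_mul, P, Matrix.of_apply,
        PowerSeries.coeff_mk]
      rw [pow_succ', Matrix.mul_apply, sub_self, Matrix.one_apply]
      split_ifs <;> simp [PowerSeries.coeff_one]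
  have hadj : W.oneSubX.adjugate = W.oneSubX.det • P := by
    calc W.oneSubX.adjugate = W.oneSubX.adjugate * (W.oneSubX * P) := by rw [hP, Matrix.mul_one]
      _ = _ := by rw [← Matrix.mul_assoc, Matrix.adjugate_mul, Matrix.smul_mul, Matrix.one_mul]
  have hD : W.oneSubX.map (d⁄dX R) = -(W.map (PowerSeries.C (R := R))) := by
    ext1 i j
    have h1 : d⁄dX R ((1 : Matrix ι ι R⟦X⟧) i j) = 0 := by
      rw [Matrix.one_apply]; split_ifs <;> simp
    simp only [Matrix.oneSubX, Matrix.map_apply, Matrix.sub_apply, Matrix.smul_apply, map_sub, h1]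
    simp
  rw [Derivation.det_eq_trace, hadj, hD, Matrix.smul_mul, Matrix.trace_smul, Matrix.mul_neg,
    Matrix.trace_neg, smul_eq_mul, mul_neg, mul_neg, mul_left_comm]
  congr 2
  ext n
  cases n with
  | zero => simp [Matrix.traceSeries]
  | succ n =>
    rw [PowerSeries.coeff_succ_X_mul, Matrix.traceSeries, PowerSeries.coeff_mk,
      if_neg n.succ_ne_zero, Matrix.trace, Matrix.trace, map_sum, pow_succ]
    refine Finset.sum_congr rfl fun i _ => ?_
    simp [P, Matrix.diag, Matrix.mul_apply, PowerSeries.coeff_mul_C]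

theorem Matrix.constantCoeff_det_oneSubX [Fintype ι] [DecidableEq ι] (W : Matrix ι ι R) :
    PowerSeries.constantCoeff W.oneSubX.det = 1 := by
  rw [RingHom.map_det]
  have : (PowerSeries.constantCoeff (R := R)).mapMatrix W.oneSubX = 1 := by
    ext i j
    simp [Matrix.oneSubX, Matrix.one_apply]
  rw [this, Matrix.det_one]

/-- The series `t` times the logarithmic derivative of `1 / (1 - a t ^ l)`. -/
noncomputable def PowerSeries.geomLog (a : R) (l : ℕ) : R⟦X⟧ :=
  PowerSeries.mk fun n => if n ≠ 0 ∧ l ∣ n then (l : R) * a ^ (n / l) else 0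

/-- Expands l a t^l / (1 - a t^l) as Σ l a^k t^(lk) over k ≥ 1, cleared of denominators. -/
theorem PowerSeries.X_mul_derivative_one_sub (a : R) {l : ℕ} (hl : 0 < l) :
    PowerSeries.X * d⁄dX R (1 - PowerSeries.C a * PowerSeries.X ^ l) =
      -((1 - PowerSeries.C a * PowerSeries.X ^ l) * PowerSeries.geomLog a l) := by
  have h1 : PowerSeries.X * d⁄dX R (1 - PowerSeries.C a * PowerSeries.X ^ l) =
      -(PowerSeries.C ((l : R) * a) * PowerSeries.X ^ l) := by
    obtain ⟨k, rfl⟩ : ∃ k, l = k + 1 := ⟨l - 1, by lia⟩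
    rw [map_sub, Derivation.leibniz, PowerSeries.derivative_pow]
    simp [pow_succ]
    ring
  rw [h1, sub_mul, one_mul, neg_inj, mul_assoc]
  ext n
  rw [map_sub, PowerSeries.coeff_C_mul, PowerSeries.coeff_C_mul, PowerSeries.coeff_X_pow_mul',
    PowerSeries.coeff_X_pow, geomLog, PowerSeries.coeff_mk, PowerSeries.coeff_mk]
  rcases lt_trichotomy n l with h | h | h
  · have : ¬ (n ≠ 0 ∧ l ∣ n) := fun ⟨h0, hd⟩ => by
      have := Nat.le_of_dvd (by lia) hd; lia
    simp [h.ne, h.not_ge, this]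
  · subst h
    simp [hl.ne', Nat.div_self hl]
  -- Above degree l, the coefficients at n and n - l cancel: the divisibility condition is the same
  -- for both, and the exponent of a drops by one.
  · have h3 : (n ≠ 0 ∧ l ∣ n) ↔ (n - l ≠ 0 ∧ l ∣ n - l) := by
      rw [Nat.dvd_sub_self_right]
      constructor
      · rintro ⟨_, h4⟩; exact ⟨by lia, Or.inl h4⟩
      · rintro ⟨_, h4⟩; exact ⟨by lia, h4.resolve_right (by lia)⟩
    by_cases h4 : n ≠ 0 ∧ l ∣ n
    · have h5 : n / l = (n - l) / l + 1 := by
        rw [← Nat.add_div_right _ hl, Nat.sub_add_cancel h.le]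
      rw [if_neg h.ne', if_pos h4, if_pos h.le, if_pos (h3.mp h4), h5]
      ring
    · rw [if_neg h.ne', if_neg h4, if_pos h.le, if_neg (fun h5 => h4 (h3.mpr h5))]
      ring

/-- Logarithmic derivatives turn products into sums. -/
theorem PowerSeries.X_mul_derivative_prod [DecidableEq ι] (s : Finset ι) (f g : ι → R⟦X⟧)
    (h : ∀ i ∈ s, PowerSeries.X * d⁄dX R (f i) = -(f i * g i)) :
    PowerSeries.X * d⁄dX R (∏ i ∈ s, f i) = -((∏ i ∈ s, f i) * ∑ i ∈ s, g i) := by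
  rw [Derivation.leibniz_finset_prod, Finset.mul_sum, Finset.mul_sum, ← Finset.sum_neg_distrib]
  refine Finset.sum_congr rfl fun i hi => ?_
  rw [mul_left_comm, h i hi, ← Finset.mul_prod_erase s f hi]
  ring

/-- Power series with constant coefficient `1` are determined, up to a given degree, by their
logarithmic derivatives. -/
theorem PowerSeries.coeff_eq_of_logDerivative_eq [IsAddTorsionFree R] {F Q S T : R⟦X⟧} {N : ℕ}
    (hF : PowerSeries.X * d⁄dX R F = -(F * S)) (hQ : PowerSeries.X * d⁄dX R Q = -(Q * T))
    (hF0 : PowerSeries.constantCoeff F = PowerSeries.constantCoeff Q)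
    (hST : ∀ n ≤ N, PowerSeries.coeff n S = PowerSeries.coeff n T)
    (hS0 : PowerSeries.constantCoeff S = 0) :
    ∀ n ≤ N, PowerSeries.coeff n F = PowerSeries.coeff n Q := by
  intro n
  induction n using Nat.strong_induction_on with
  | _ n ih =>
    intro hn
    cases n with
    | zero => simpa using hF0
    | succ n =>
      have h1 := congrArg (PowerSeries.coeff (n + 1)) hF
      have h2 := congrArg (PowerSeries.coeff (n + 1)) hQ
      rw [PowerSeries.coeff_succ_X_mul, PowerSeries.coeff_derivative, map_neg,
        PowerSeries.coeff_mul] at h1 h2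
      have h3 : ∑ p ∈ Finset.HasAntidiagonal.antidiagonal (n + 1), PowerSeries.coeff p.1 F * PowerSeries.coeff p.2 S
          = ∑ p ∈ Finset.HasAntidiagonal.antidiagonal (n + 1), PowerSeries.coeff p.1 Q * PowerSeries.coeff p.2 T := by
        refine Finset.sum_congr rfl fun p hp => ?_
        rw [Finset.HasAntidiagonal.mem_antidiagonal] at hp
        rw [← hST p.2 (by lia)]
        -- Only the term with `p.2 = 0` involves the still unknown coefficient of index n + 1; it
        -- vanishes because S has no constant term.
        rcases Nat.eq_zero_or_pos p.2 with h0 | h0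
        · rw [h0, PowerSeries.coeff_zero_eq_constantCoeff_apply, hS0, mul_zero, mul_zero]
        · rw [ih p.1 (by lia) (by lia)]
      rw [h3, ← h2] at h1
      have h4 : (n + 1) • PowerSeries.coeff (n + 1) F = (n + 1) • PowerSeries.coeff (n + 1) Q := by
        simp only [nsmul_eq_mul]
        push_cast
        linear_combination h1
      exact nsmul_right_injective n.succ_ne_zero h4

end LogDerivative

/-! ### Periodic sequences -/

section Sequences

variable {E : Type*}

/-- The shift of one-sided sequences. -/
def seqShift (x : ℕ → E) : ℕ → E := fun i => x (i + 1)

theorem seqShift_iterate_apply (n : ℕ) (x : ℕ → E) (i : ℕ) : (seqShift^[n] x) i = x (i + n) := by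
  induction n generalizing x with
  | zero => rfl
  | succ n ih => rw [Function.iterate_succ_apply, ih]; exact congrArg x (by lia)

theorem isPeriodicPt_seqShift_iff {n : ℕ} {x : ℕ → E} :
    Function.IsPeriodicPt seqShift n x ↔ ∀ i, x (i + n) = x i := by
  constructor
  · intro h i
    rw [← seqShift_iterate_apply n x, h]
  · intro h
    funext i
    rw [seqShift_iterate_apply, h]

theorem apply_mod_of_isPeriodicPt {n : ℕ} {x : ℕ → E} (h : Function.IsPeriodicPt seqShift n x)
    (i : ℕ) : x (i % n) = x i := by
  have := congrFun (h.iterate_mod_apply i) 0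
  rwa [seqShift_iterate_apply, seqShift_iterate_apply, zero_add, zero_add] at this

/-- The periodic sequence with the values of a nonempty list. -/
def List.cyc (l : List E) (h : 0 < l.length) : ℕ → E := fun i => l[i % l.length]'(Nat.mod_lt _ h)

theorem List.isPeriodicPt_cyc (l : List E) (h : 0 < l.length) :
    Function.IsPeriodicPt seqShift l.length (l.cyc h) :=
  isPeriodicPt_seqShift_iff.mpr fun i => by simp [List.cyc]

theorem List.ofFn_seq_congr (x : ℕ → E) {m n : ℕ} (h : m = n) :
    (List.ofFn fun i : Fin m => x i) = List.ofFn fun i : Fin n => x i := by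
  subst h; rfl

theorem List.ofFn_cyc (l : List E) (h : 0 < l.length) :
    (List.ofFn fun i : Fin l.length => l.cyc h i) = l := by
  apply List.ext_getElem
  · simp
  · intro i h1 h2
    simp [List.cyc, Nat.mod_eq_of_lt h2]

theorem List.cyc_ofFn {n : ℕ} {x : ℕ → E} (hx : Function.IsPeriodicPt seqShift n x)
    (h : 0 < (List.ofFn fun i : Fin n => x i).length) :
    (List.ofFn fun i : Fin n => x i).cyc h = x := by
  funext i
  simp [List.cyc, apply_mod_of_isPeriodicPt hx]

theorem List.cyc_rotate (l : List E) (k : ℕ) (h : 0 < l.length) (h' : 0 < (l.rotate k).length) :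
    (l.rotate k).cyc h' = seqShift^[k] (l.cyc h) := by
  funext i
  rw [seqShift_iterate_apply]
  simp [List.cyc, List.getElem_rotate]

theorem List.cyc_congr {l l' : List E} (hl : l = l') (h : 0 < l.length) (h' : 0 < l'.length) :
    l.cyc h = l'.cyc h' := by
  subst hl; rfl

theorem List.flatten_replicate_eq_ofFn (l : List E) (h : 0 < l.length) (k : ℕ) :
    (List.replicate k l).flatten = List.ofFn fun i : Fin (k * l.length) => l.cyc h i := by
  rw [List.ofFn_mul, ← List.ofFn_const]
  congr 2
  funext i
  conv_lhs => rw [← l.ofFn_cyc h]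
  congr 1
  funext j
  simp [List.cyc]

/-- The product of the entries of a matrix along the first `n` steps of a sequence. -/
def seqWeight {R : Type*} [CommMonoid R] (W : Matrix E E R) (n : ℕ) (x : ℕ → E) : R :=
  ∏ i ∈ Finset.range n, W (x i) (x (i + 1))

variable {R : Type*}

/-- The shift drops the factor of the first step and gains that of the step from n to n + 1, which
is the same step by periodicity. -/
theorem seqWeight_seqShift [CommMonoid R] (W : Matrix E E R) {n : ℕ} {x : ℕ → E}
    (hx : Function.IsPeriodicPt seqShift n x) : seqWeight W n (seqShift x) = seqWeight W n x := by
  cases n with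
  | zero => rfl
  | succ n =>
    have h := isPeriodicPt_seqShift_iff.mp hx
    simp only [seqWeight, seqShift]
    rw [Finset.prod_range_succ, Finset.prod_range_succ' (fun i => W (x i) (x (i + 1)))]
    congr 2
    · simpa using h 0
    · rw [← h (0 + 1)]; exact congrArg x (by lia)

theorem seqWeight_iterate_seqShift [CommMonoid R] (W : Matrix E E R) {n : ℕ} {x : ℕ → E}
    (hx : Function.IsPeriodicPt seqShift n x) (k : ℕ) :
    seqWeight W n (seqShift^[k] x) = seqWeight W n x := by
  induction k with
  | zero => rfl
  | succ k ih =>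
    rw [Function.iterate_succ_apply', seqWeight_seqShift W (hx.apply_iterate k), ih]

theorem seqWeight_mul [CommMonoid R] (W : Matrix E E R) {n : ℕ} {x : ℕ → E}
    (hx : Function.IsPeriodicPt seqShift n x) (k : ℕ) :
    seqWeight W (k * n) x = seqWeight W n x ^ k := by
  induction k with
  | zero => simp [seqWeight]
  | succ k ih =>
    rw [Nat.succ_mul, pow_succ, ← ih, seqWeight, Finset.prod_range_add]
    congr 1
    have h := isPeriodicPt_seqShift_iff.mp (hx.const_mul k)
    refine Finset.prod_congr rfl fun i _ => ?_
    rw [← h i, ← h (i + 1)]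
    congr 2 <;> lia

/-- The entries of a power of a matrix, as sums over paths. -/
theorem Matrix.pow_succ_apply_eq_sum [Fintype E] [DecidableEq E] [CommSemiring R]
    (W : Matrix E E R) (n : ℕ) (e f : E) :
    (W ^ (n + 1)) e f = ∑ v : Fin n → E, ∏ i : Fin (n + 1),
      W ((Fin.cons e v : Fin (n + 1) → E) i) ((Fin.snoc v f : Fin (n + 1) → E) i) := by
  induction n generalizing e with
  | zero => simp [Fin.snoc]
  | succ n ih =>
    rw [pow_succ', Matrix.mul_apply, ← (Fin.consEquiv fun _ => E).sum_comp, Fintype.sum_prod_type]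
    refine Finset.sum_congr rfl fun a _ => ?_
    rw [ih, Finset.mul_sum]
    refine Finset.sum_congr rfl fun v _ => ?_
    rw [Fin.prod_univ_succ (n := n + 1)]
    have h : (Fin.snoc (Fin.cons a v : Fin (n + 1) → E) f : Fin (n + 2) → E) =
        Fin.cons a (Fin.snoc v f : Fin (n + 1) → E) :=
      (Fin.cons_snoc_eq_snoc_cons a v f).symm
    simp [Fin.consEquiv, h]

/-- The periodic sequence with given values on `Fin n`. -/
def finCyc {n : ℕ} (hn : 0 < n) (w : Fin n → E) : ℕ → E := fun i => w ⟨i % n, Nat.mod_lt _ hn⟩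

theorem isPeriodicPt_finCyc {n : ℕ} (hn : 0 < n) (w : Fin n → E) :
    Function.IsPeriodicPt seqShift n (finCyc hn w) :=
  isPeriodicPt_seqShift_iff.mpr fun i => by simp [finCyc]

theorem finCyc_eq {n : ℕ} (hn : 0 < n) {x : ℕ → E} (hx : Function.IsPeriodicPt seqShift n x) :
    finCyc hn (fun i => x i) = x :=
  funext fun i => apply_mod_of_isPeriodicPt hx i

/-- The trace of a power of a matrix, as a sum over periodic sequences. -/
theorem Matrix.trace_pow_eq_sum [Fintype E] [DecidableEq E] [CommSemiring R] (W : Matrix E E R)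
    {n : ℕ} (hn : 0 < n) : (W ^ n).trace = ∑ w : Fin n → E, seqWeight W n (finCyc hn w) := by
  obtain ⟨n, rfl⟩ : ∃ k, n = k + 1 := ⟨n - 1, by lia⟩
  rw [← (Fin.consEquiv fun _ => E).sum_comp, Fintype.sum_prod_type, Matrix.trace]
  refine Finset.sum_congr rfl fun e _ => ?_
  rw [Matrix.diag_apply, Matrix.pow_succ_apply_eq_sum]
  refine Finset.sum_congr rfl fun v _ => ?_
  rw [seqWeight, Finset.prod_range]
  refine Finset.prod_congr rfl fun i _ => ?_
  have h1 : finCyc hn ((Fin.consEquiv fun _ => E) (e, v)) i =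
      (Fin.cons e v : Fin (n + 1) → E) i := by
    simp only [finCyc, Nat.mod_eq_of_lt i.isLt]
    rfl
  have h2 : finCyc hn ((Fin.consEquiv fun _ => E) (e, v)) (i + 1) =
      (Fin.snoc v e : Fin (n + 1) → E) i := by
    -- The last index wraps around to the starting entry e, which closes the path.
    induction i using Fin.lastCases with
    | last => simp [finCyc, Fin.consEquiv]
    | cast j =>
      have h3 : (⟨(j.castSucc.val + 1) % (n + 1), Nat.mod_lt _ hn⟩ : Fin (n + 1)) = j.succ := by
        ext; simp
      simp only [finCyc, h3]
      simp [Fin.consEquiv]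
  rw [h1, h2]

end Sequences

/-! ### Circuits and periodic sequences -/

namespace InvGraph

variable {V E : Type*} {G : InvGraph V E}

variable (G) in
/-- Consecutive edges of the sequence are composable. -/
def IsWalk (x : ℕ → E) : Prop := ∀ i, G.tgt (x i) = G.src (x (i + 1))

theorem isPath_ofFn {n : ℕ} {x : ℕ → E} {v w : V} :
    G.IsPath v (List.ofFn fun i : Fin (n + 1) => x i) w ↔
      G.src (x 0) = v ∧ (∀ i < n, G.tgt (x i) = G.src (x (i + 1))) ∧ G.tgt (x n) = w := by
  induction n generalizing x v with
  | zero => simp [IsPath]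
  | succ n ih =>
    rw [List.ofFn_succ]
    have := ih (x := fun i => x (i + 1)) (v := G.tgt (x 0))
    simp only [IsPath, Fin.val_succ, Fin.val_zero, this]
    refine and_congr Iff.rfl ?_
    constructor
    · rintro ⟨h1, h2, h3⟩
      refine ⟨fun i hi => ?_, h3⟩
      cases i with
      | zero => exact h1.symm
      | succ i => exact h2 i (by lia)
    · rintro ⟨h1, h2⟩
      exact ⟨(h1 0 (by lia)).symm, fun i hi => h1 (i + 1) (by lia), h2⟩

namespace Circuit

@[ext]
theorem ext' {c d : G.Circuit} (hb : c.base = d.base) (he : c.edges = d.edges) : c = d := by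
  cases c; cases d; cases hb; cases he; rfl

/-- The periodic sequence of edges of a circuit. -/
def seq (c : G.Circuit) (h : 0 < c.length) : ℕ → E := c.edges.cyc h

theorem isPeriodicPt_seq (c : G.Circuit) (h : 0 < c.length) :
    Function.IsPeriodicPt seqShift c.length (c.seq h) := c.edges.isPeriodicPt_cyc h

theorem ofFn_seq (c : G.Circuit) (h : 0 < c.length) :
    (List.ofFn fun i : Fin c.length => c.seq h i) = c.edges := c.edges.ofFn_cyc h

theorem seq_path (c : G.Circuit) (h : 0 < c.length) : G.src (c.seq h 0) = c.base ∧
    (∀ i < c.length - 1, G.tgt (c.seq h i) = G.src (c.seq h (i + 1))) ∧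
    G.tgt (c.seq h (c.length - 1)) = c.base := by
  rw [← isPath_ofFn, List.ofFn_seq_congr (c.seq h) (Nat.sub_add_cancel h), c.ofFn_seq h]
  exact c.isPath

theorem isWalk_seq (c : G.Circuit) (h : 0 < c.length) : G.IsWalk (c.seq h) := by
  obtain ⟨h1, h2, h3⟩ := c.seq_path h
  have hp := isPeriodicPt_seqShift_iff.mp (c.isPeriodicPt_seq h)
  have key : ∀ i < c.length, G.tgt (c.seq h i) = G.src (c.seq h (i + 1)) := by
    intro i hi
    rcases Nat.lt_or_ge i (c.length - 1) with h4 | h4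
    · exact h2 i h4
    · obtain rfl : i = c.length - 1 := by lia
      rw [h3, Nat.sub_add_cancel h, ← h1, ← hp 0, zero_add]
  intro i
  have h5 := key (i % c.length) (Nat.mod_lt _ h)
  rwa [apply_mod_of_isPeriodicPt (c.isPeriodicPt_seq h),
    ← apply_mod_of_isPeriodicPt (c.isPeriodicPt_seq h) (i % c.length + 1), Nat.mod_add_mod,
    apply_mod_of_isPeriodicPt (c.isPeriodicPt_seq h)] at h5

/-- The circuit of length `n` given by an `n`-periodic walk. -/
def ofSeq {x : ℕ → E} (hx : G.IsWalk x) {n : ℕ} (hn : 0 < n)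
    (hp : Function.IsPeriodicPt seqShift n x) : G.Circuit where
  base := G.src (x 0)
  edges := List.ofFn fun i : Fin n => x i
  isPath := by
    obtain ⟨n, rfl⟩ : ∃ k, n = k + 1 := ⟨n - 1, by lia⟩
    refine isPath_ofFn.mpr ⟨rfl, fun i _ => hx i, ?_⟩
    rw [hx n, ← isPeriodicPt_seqShift_iff.mp hp 0, zero_add]

section ofSeq

variable {x : ℕ → E} (hx : G.IsWalk x) {n : ℕ} (hn : 0 < n)
  (hp : Function.IsPeriodicPt seqShift n x)

@[simp]
theorem length_ofSeq : (ofSeq hx hn hp).length = n := by simp [ofSeq, length]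

theorem seq_ofSeq (h : 0 < (ofSeq hx hn hp).length) : (ofSeq hx hn hp).seq h = x :=
  List.cyc_ofFn hp h

end ofSeq

theorem length_pow (c : G.Circuit) (k : ℕ) : (c.pow k).length = k * c.length := by
  simp [pow, length]

theorem seq_pow (c : G.Circuit) (k : ℕ) (h : 0 < c.length) (h' : 0 < (c.pow k).length) :
    (c.pow k).seq h' = c.seq h := by
  have h1 : (c.pow k).edges = List.ofFn fun i : Fin (k * c.edges.length) => c.edges.cyc h i :=
    c.edges.flatten_replicate_eq_ofFn h k
  have h2 : 0 < (List.ofFn fun i : Fin (k * c.edges.length) => c.edges.cyc h i).length := by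
    rw [← h1]; exact h'
  exact (List.cyc_congr h1 h' h2).trans (List.cyc_ofFn ((c.isPeriodicPt_seq h).const_mul k) h2)

theorem eq_of_seq_eq {c d : G.Circuit} (hc : 0 < c.length) (hl : c.length = d.length)
    (h : c.seq hc = d.seq (hl ▸ hc)) : c = d := by
  have hb : c.base = d.base := by
    rw [← (c.seq_path hc).1, h, (d.seq_path _).1]
  refine ext' hb ?_
  rw [← c.ofFn_seq hc, ← d.ofFn_seq (hl ▸ hc), h]
  exact List.ofFn_seq_congr _ hl

theorem length_eq_of_toCycle_eq {c d : G.Circuit} (h : G.toCycle c = G.toCycle d) :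
    c.length = d.length :=
  (Quotient.exact h : _ ∧ _).1.perm.length_eq

/-- Rotating the edge list is shifting the periodic sequence; the condition on base vertices is
vacuous in positive length. -/
theorem toCycle_eq_iff {c d : G.Circuit} (hc : 0 < c.length) (hd : 0 < d.length) :
    G.toCycle c = G.toCycle d ↔
      c.length = d.length ∧ ∃ k < c.length, seqShift^[k] (c.seq hc) = d.seq hd := by
  constructor
  · intro h
    refine ⟨length_eq_of_toCycle_eq h, ?_⟩
    obtain ⟨⟨k, hk⟩, -⟩ := (Quotient.exact h : _ ∧ _)
    refine ⟨k % c.length, Nat.mod_lt _ hc, ?_⟩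
    rw [(c.isPeriodicPt_seq hc).iterate_mod_apply]
    have h1 : 0 < (c.edges.rotate k).length := by rw [hk]; exact hd
    exact (List.cyc_rotate _ _ hc h1).symm.trans (List.cyc_congr hk h1 hd)
  · rintro ⟨hl, k, -, hk⟩
    have h1 : 0 < (c.edges.rotate k).length := by simpa [length] using hc
    have h2 : c.edges.rotate k = d.edges := by
      rw [← d.ofFn_seq hd, ← List.ofFn_cyc _ h1, List.cyc_rotate _ _ hc]
      have h3 : (c.edges.rotate k).length = d.length := by simpa [length] using hl
      rw [← hk]
      exact List.ofFn_seq_congr _ h3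
    refine Quotient.sound ⟨⟨k, h2⟩, fun h3 => ?_⟩
    simp [length, h3] at hc

theorem pos_of_isPrimitive {c : G.Circuit} (hc : (G.toCycle c).IsPrimitive) : 0 < c.length := by
  by_contra h
  have h0 : c.edges = [] := List.length_eq_zero_iff.mp (by simpa [length] using h)
  exact hc c rfl ⟨c, 2, le_rfl, ext' rfl (by simp [pow, h0])⟩

/-- If the minimal period were a proper divisor of the length, the circuit would be a proper power
of the circuit cut off after one minimal period. -/
theorem minimalPeriod_of_isPrimitive {c : G.Circuit} (hc : (G.toCycle c).IsPrimitive)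
    (h : 0 < c.length) : Function.minimalPeriod seqShift (c.seq h) = c.length := by
  have hp := c.isPeriodicPt_seq h
  obtain ⟨k, hk⟩ := hp.minimalPeriod_dvd
  have h0 := hp.minimalPeriod_pos h
  have hm := Function.isPeriodicPt_minimalPeriod seqShift (c.seq h)
  by_contra hne
  have hk2 : 2 ≤ k := by
    rcases k with _ | _ | k
    · simp at hk; lia
    · simp at hk; exact absurd hk.symm hne
    · lia
  refine hc c rfl ⟨ofSeq (c.isWalk_seq h) h0 hm, k, hk2, ?_⟩
  have hl : c.length = ((ofSeq (c.isWalk_seq h) h0 hm).pow k).length := by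
    rw [length_pow, length_ofSeq, mul_comm, ← hk]
  refine eq_of_seq_eq h hl ?_
  rw [seq_pow _ k (by rwa [length_ofSeq]), seq_ofSeq]

/-- If some representative is p^k with k ≥ 2, the sequence is a shift of that of p and has the
smaller period |p|. -/
theorem isPrimitive_of_minimalPeriod {c : G.Circuit} (h : 0 < c.length)
    (hc : Function.minimalPeriod seqShift (c.seq h) = c.length) : (G.toCycle c).IsPrimitive := by
  rintro d hd ⟨p, k, hk, rfl⟩
  have hl := length_eq_of_toCycle_eq hd
  have h1 : 0 < (p.pow k).length := hl ▸ h
  have hlp := p.length_pow k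
  have h2 : 0 < p.length := Nat.pos_of_ne_zero fun h0 => by simp [h0] at hlp; lia
  obtain ⟨-, j, -, hj⟩ := (toCycle_eq_iff h1 h).mp hd
  rw [← hj, seq_pow p k h2, Function.minimalPeriod_apply_iterate
    (Function.mk_mem_periodicPts h2 (p.isPeriodicPt_seq h2))] at hc
  have h3 := (p.isPeriodicPt_seq h2).minimalPeriod_le h2
  nlinarith

end Circuit

end InvGraph

namespace InvGraph

variable {V E : Type*} (G : InvGraph V E)

theorem tgt_inv (e : E) : G.tgt (G.inv e) = G.src e := by rw [← G.src_inv, G.inv_inv]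

/-! ### Periodic walks and chosen circuits -/

namespace IsPrimitiveRepresentatives

variable {G} {C : Set G.Circuit} (hC : G.IsPrimitiveRepresentatives C)
include hC

theorem isPrimitive (c : C) : (G.toCycle c.1).IsPrimitive := hC.mapsTo c.2

theorem length_pos (c : C) : 0 < c.1.length := Circuit.pos_of_isPrimitive (hC.isPrimitive c)

theorem minimalPeriod_seq (c : C) :
    Function.minimalPeriod seqShift (c.1.seq (hC.length_pos c)) = c.1.length :=
  Circuit.minimalPeriod_of_isPrimitive (hC.isPrimitive c) _

theorem mem_periodicPts (c : C) : c.1.seq (hC.length_pos c) ∈ Function.periodicPts seqShift :=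
  Function.mk_mem_periodicPts (hC.length_pos c) (c.1.isPeriodicPt_seq _)

/-- A periodic walk is a shift of the sequence of at most one chosen circuit, by at most one
number less than its length. -/
theorem seq_injective {c d : C} {i j : ℕ} (hi : i < c.1.length) (hj : j < d.1.length)
    (h : seqShift^[i] (c.1.seq (hC.length_pos c)) = seqShift^[j] (d.1.seq (hC.length_pos d))) :
    c = d ∧ i = j := by
  have hl : c.1.length = d.1.length := by
    rw [← hC.minimalPeriod_seq c, ← hC.minimalPeriod_seq d,
      ← Function.minimalPeriod_apply_iterate (hC.mem_periodicPts c) i, h,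
      Function.minimalPeriod_apply_iterate (hC.mem_periodicPts d)]
  have hcd : c = d := by
    refine Subtype.ext (hC.injOn c.2 d.2 ?_)
    -- After i shifts the sequence of c is that of d shifted by j; `d.1.length - j` further shifts
    -- complete a period of d.
    refine (Circuit.toCycle_eq_iff (hC.length_pos c) (hC.length_pos d)).mpr ⟨hl,
      (d.1.length - j + i) % c.1.length, Nat.mod_lt _ (hC.length_pos c), ?_⟩
    rw [(c.1.isPeriodicPt_seq _).iterate_mod_apply, Function.iterate_add_apply, h,
      ← Function.iterate_add_apply, Nat.sub_add_cancel hj.le]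
    exact d.1.isPeriodicPt_seq _
  subst hcd
  refine ⟨rfl, (Function.iterate_eq_iterate_iff_of_lt_minimalPeriod ?_ ?_).mp h⟩ <;>
    rwa [hC.minimalPeriod_seq]

/-- A periodic walk is a shift of the sequence of a chosen circuit, by a number less than its
length. -/
theorem exists_seq_eq {x : ℕ → E} (hx : G.IsWalk x) {n : ℕ} (hn : 0 < n)
    (hp : Function.IsPeriodicPt seqShift n x) : ∃ (c : C) (i : ℕ), i < c.1.length ∧
      c.1.length ∣ n ∧ seqShift^[i] (c.1.seq (hC.length_pos c)) = x := by
  -- The circuit formed by one minimal period of x is primitive, so its cycle has a chosen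
  -- representative.
  have hd := hp.minimalPeriod_pos hn
  have hm := Function.isPeriodicPt_minimalPeriod seqShift x
  have hl := Circuit.length_ofSeq hx hd hm
  have h0 : 0 < (Circuit.ofSeq hx hd hm).length := by rwa [hl]
  obtain ⟨c, hc, he⟩ := hC.surjOn (show G.toCycle (Circuit.ofSeq hx hd hm) ∈ _ from
    Circuit.isPrimitive_of_minimalPeriod h0 (by rw [Circuit.seq_ofSeq, hl]))
  obtain ⟨hl', k, hk, he⟩ := (Circuit.toCycle_eq_iff (hC.length_pos ⟨c, hc⟩) h0).mp he
  refine ⟨⟨c, hc⟩, k, hk, ?_, ?_⟩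
  · rw [hl', hl]; exact hp.minimalPeriod_dvd
  · rw [he, Circuit.seq_ofSeq]

theorem finite_length_le [Finite E] (N : ℕ) : {c : C | c.1.length ≤ N}.Finite := by
  have h : Function.Injective fun c : C => c.1.edges := by
    intro c d h
    refine Subtype.ext (Circuit.eq_of_seq_eq (hC.length_pos c) (congrArg List.length h) ?_)
    exact List.cyc_congr h _ _
  exact Set.Finite.preimage h.injOn (List.finite_length_le E N)

theorem isUnit_factor [DecidableEq E] (c : C) :
    IsUnit (1 - uS ^ c.1.cyclicBumpCount * tS ^ c.1.length : ℤ[X]⟦X⟧) := by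
  rw [PowerSeries.isUnit_iff_constantCoeff]
  simp [tS, (hC.length_pos c).ne']

end IsPrimitiveRepresentatives

variable [DecidableEq V] [DecidableEq E]

/-! ### Weights of circuits and traces -/

/-- The matrix `B - (1 - u) J`: transitions between composable edges have weight `1`, bumps have
weight `u`. -/
noncomputable def bumpMatrix : Matrix E E ℤ[X] :=
  Matrix.of fun e f => (if G.tgt e = G.src f then 1 else 0) -
    (1 - Polynomial.X) * if G.inv e = f then 1 else 0

variable {G}

theorem bumpMatrix_apply_of_composable {e f : E} (h : G.tgt e = G.src f) :
    G.bumpMatrix e f = if e = G.inv f then Polynomial.X else 1 := by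
  have h1 : G.inv e = f ↔ e = G.inv f :=
    ⟨fun h => by rw [← h, G.inv_inv], fun h => by rw [h, G.inv_inv]⟩
  simp only [bumpMatrix, Matrix.of_apply, h, h1]
  split_ifs <;> simp

/-- An edge is always composable with its inverse, so the J-term vanishes along with the B-term. -/
theorem bumpMatrix_apply_of_not_composable {e f : E} (h : G.tgt e ≠ G.src f) :
    G.bumpMatrix e f = 0 := by
  have h1 : G.inv e ≠ f := fun h1 => h (by rw [← h1, G.src_inv])
  simp [bumpMatrix, h, h1]

theorem Circuit.seqWeight_seq (c : G.Circuit) (h : 0 < c.length) :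
    seqWeight G.bumpMatrix c.length (c.seq h) = Polynomial.X ^ c.cyclicBumpCount := by
  have h1 : seqWeight G.bumpMatrix c.length (c.seq h) = ∏ i : Fin c.edges.length,
      if c.seq h i = G.inv (c.seq h (i + 1)) then (Polynomial.X : ℤ[X]) else 1 := by
    rw [seqWeight, Finset.prod_range]
    exact Finset.prod_congr rfl fun i _ => bumpMatrix_apply_of_composable (c.isWalk_seq h i)
  rw [h1, Finset.prod_ite, Finset.prod_const, Finset.prod_const_one, mul_one, cyclicBumpCount]
  congr 2
  refine Finset.filter_congr fun i _ => ?_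
  simp [seq, List.cyc, Nat.mod_eq_of_lt i.isLt]

theorem seqWeight_eq_zero {n : ℕ} (hn : 0 < n) {x : ℕ → E}
    (hp : Function.IsPeriodicPt seqShift n x) (hx : ¬ G.IsWalk x) :
    seqWeight G.bumpMatrix n x = 0 := by
  simp only [IsWalk, not_forall] at hx
  obtain ⟨i, hi⟩ := hx
  refine Finset.prod_eq_zero (Finset.mem_range.mpr (Nat.mod_lt i hn)) ?_
  apply bumpMatrix_apply_of_not_composable
  rwa [← apply_mod_of_isPeriodicPt hp (i % n + 1), Nat.mod_add_mod, apply_mod_of_isPeriodicPt hp,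
    apply_mod_of_isPeriodicPt hp]

namespace IsPrimitiveRepresentatives

variable {C : Set G.Circuit} (hC : G.IsPrimitiveRepresentatives C)
include hC

/-- Every circuit of positive length is a power of a rotation of a unique chosen circuit. -/
theorem trace_pow_bumpMatrix [Fintype E] {n : ℕ} (hn : 0 < n) (s : Finset C)
    (hs : ∀ c : C, c.1.length ≤ n → c ∈ s) :
    (G.bumpMatrix ^ n).trace = ∑ c ∈ s, if c.1.length ∣ n then
      (c.1.length : ℤ[X]) * (Polynomial.X ^ c.1.cyclicBumpCount) ^ (n / c.1.length) else 0 := by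
  classical
  have hper : ∀ c : C, c.1.length ∣ n → ∀ i,
      Function.IsPeriodicPt seqShift n (seqShift^[i] (c.1.seq (hC.length_pos c))) :=
    fun c h i => ((c.1.isPeriodicPt_seq _).trans_dvd h).apply_iterate i
  have hw : ∀ c : C, c.1.length ∣ n → ∀ i,
      seqWeight G.bumpMatrix n (seqShift^[i] (c.1.seq (hC.length_pos c))) =
        (Polynomial.X ^ c.1.cyclicBumpCount) ^ (n / c.1.length) := by
    intro c h i
    rw [seqWeight_iterate_seqShift _ ((c.1.isPeriodicPt_seq _).trans_dvd h),
      ← c.1.seqWeight_seq (hC.length_pos c), ← seqWeight_mul _ (c.1.isPeriodicPt_seq _),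
      Nat.div_mul_cancel h]
  rw [Matrix.trace_pow_eq_sum _ hn, ← Finset.sum_filter]
  have h1 : ∑ w : Fin n → E, seqWeight G.bumpMatrix n (finCyc hn w) =
      ∑ w : Fin n → E with G.IsWalk (finCyc hn w), seqWeight G.bumpMatrix n (finCyc hn w) := by
    refine (Finset.sum_subset (Finset.filter_subset _ _) fun w _ h => ?_).symm
    exact seqWeight_eq_zero hn (isPeriodicPt_finCyc hn w) fun h' => h (by simp [h'])
  -- The factor |c| counts the starting points on c, all of which give the same weight.
  have h2 : ∀ c ∈ s.filter fun c : C => c.1.length ∣ n,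
      (c.1.length : ℤ[X]) * (Polynomial.X ^ c.1.cyclicBumpCount) ^ (n / c.1.length) =
      ∑ i ∈ Finset.range c.1.length,
        seqWeight G.bumpMatrix n (seqShift^[i] (c.1.seq (hC.length_pos c))) := by
    intro c hc
    rw [Finset.sum_congr rfl fun i _ => hw c (Finset.mem_filter.mp hc).2 i]
    simp
  rw [h1, Finset.sum_congr rfl h2, Finset.sum_sigma']
  symm
  refine Finset.sum_bij
    (fun p _ => fun j : Fin n => seqShift^[p.2] (p.1.1.seq (hC.length_pos p.1)) j) ?_ ?_ ?_ ?_
  · rintro ⟨c, i⟩ hp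
    simp only [Finset.mem_sigma, Finset.mem_filter, Finset.mem_range] at hp
    simp only [Finset.mem_filter, Finset.mem_univ, true_and]
    rw [finCyc_eq hn (hper c hp.1.2 i)]
    intro j
    rw [seqShift_iterate_apply, seqShift_iterate_apply, c.1.isWalk_seq]
    congr 2
    lia
  · rintro ⟨c, i⟩ hp ⟨d, j⟩ hq h
    simp only [Finset.mem_sigma, Finset.mem_filter, Finset.mem_range] at hp hq
    have h3 := congrArg (finCyc hn) h
    simp only at h3
    rw [finCyc_eq hn (hper c hp.1.2 i), finCyc_eq hn (hper d hq.1.2 j)] at h3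
    obtain ⟨rfl, rfl⟩ := hC.seq_injective hp.2 hq.2 h3
    rfl
  · intro w hw'
    simp only [Finset.mem_filter, Finset.mem_univ, true_and] at hw'
    obtain ⟨c, i, hi, hd, he⟩ := hC.exists_seq_eq hw' hn (isPeriodicPt_finCyc hn w)
    refine ⟨⟨c, i⟩, ?_, ?_⟩
    · simp only [Finset.mem_sigma, Finset.mem_filter, Finset.mem_range]
      exact ⟨⟨hs c (Nat.le_of_dvd hn hd), hd⟩, hi⟩
    · funext j
      simp only [he, finCyc, Nat.mod_eq_of_lt j.isLt]
  · rintro ⟨c, i⟩ hp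
    simp only [Finset.mem_sigma, Finset.mem_filter, Finset.mem_range] at hp
    rw [finCyc_eq hn (hper c hp.1.2 i)]

/-! ### The Euler product -/

/-- Circuits in s longer than N are harmless: their lengths divide no positive n ≤ N. -/
theorem coeff_prod_eq [Fintype E] {N : ℕ} (s : Finset C) (hs : ∀ c : C, c.1.length ≤ N → c ∈ s) :
    ∀ n ≤ N, PowerSeries.coeff n G.bumpMatrix.oneSubX.det =
      PowerSeries.coeff n (∏ c ∈ s, (1 - uS ^ c.1.cyclicBumpCount * tS ^ c.1.length)) := by
  classical
  have hfac : ∀ c : C, (1 - uS ^ c.1.cyclicBumpCount * tS ^ c.1.length : ℤ[X]⟦X⟧) =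
      1 - PowerSeries.C (Polynomial.X ^ c.1.cyclicBumpCount) * PowerSeries.X ^ c.1.length :=
    fun c => by simp [uS, tS]
  refine PowerSeries.coeff_eq_of_logDerivative_eq
    (Matrix.X_mul_derivative_det_oneSubX _)
    (PowerSeries.X_mul_derivative_prod s _
      (fun c => PowerSeries.geomLog (Polynomial.X ^ c.1.cyclicBumpCount) c.1.length)
      fun c _ => by
        rw [hfac]; exact PowerSeries.X_mul_derivative_one_sub _ (hC.length_pos c)) ?_ ?_ ?_
  · rw [Matrix.constantCoeff_det_oneSubX, map_prod]
    refine (Finset.prod_eq_one fun c _ => ?_).symm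
    simp [tS, (hC.length_pos c).ne']
  · intro n hn
    rw [map_sum]
    simp only [Matrix.traceSeries, PowerSeries.geomLog, PowerSeries.coeff_mk]
    rcases Nat.eq_zero_or_pos n with rfl | h0
    · simp
    · rw [if_neg h0.ne', hC.trace_pow_bumpMatrix h0 s fun c hc => hs c (hc.trans hn)]
      refine Finset.sum_congr rfl fun c _ => ?_
      simp [h0.ne']
  · simp [Matrix.traceSeries]

theorem hasProd_zetaFactor [Fintype E] :
    HasProd (fun c : C => zetaFactor c.1) (Ring.inverse G.bumpMatrix.oneSubX.det) := by
  have hF : IsUnit G.bumpMatrix.oneSubX.det := by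
    rw [PowerSeries.isUnit_iff_constantCoeff, Matrix.constantCoeff_det_oneSubX]
    exact isUnit_one
  rw [HasProd, PowerSeries.WithPiTopology.tendsto_iff_coeff_tendsto]
  intro N
  refine tendsto_const_nhds.congr' ?_
  rw [Filter.EventuallyEq, SummationFilter.unconditional_filter, Filter.eventually_atTop]
  refine ⟨(hC.finite_length_le N).toFinset, fun s hs => ?_⟩
  have hs' : ∀ c : C, c.1.length ≤ N → c ∈ s := fun c hc => hs (by simpa using hc)
  have h1 := hC.coeff_prod_eq s hs'
  set F := G.bumpMatrix.oneSubX.det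
  set Q : ℤ[X]⟦X⟧ := ∏ c ∈ s, (1 - uS ^ c.1.cyclicBumpCount * tS ^ c.1.length)
  have hQ : Q * ∏ c ∈ s, zetaFactor c.1 = 1 := by
    rw [← Finset.prod_mul_distrib]
    exact Finset.prod_eq_one fun c _ => Ring.mul_inverse_cancel _ (hC.isUnit_factor c)
  -- Since 1/F - 1/Q = (Q - F)/(FQ), agreement of F and Q up to degree N passes to their inverses.
  have h2 : Ring.inverse F - ∏ c ∈ s, zetaFactor c.1 =
      (Ring.inverse F * ∏ c ∈ s, zetaFactor c.1) * (Q - F) := by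
    linear_combination (-Ring.inverse F) * hQ +
      (∏ c ∈ s, zetaFactor c.1) * Ring.inverse_mul_cancel F hF
  rw [← sub_eq_zero, ← map_sub, h2, PowerSeries.coeff_mul]
  refine Finset.sum_eq_zero fun p hp => ?_
  rw [Finset.HasAntidiagonal.mem_antidiagonal] at hp
  rw [map_sub, h1 p.2 (by lia), sub_self, mul_zero]

end IsPrimitiveRepresentatives

/-! ### The determinant formulas -/

variable (G)

theorem coe_matM_apply (e f : E) : ((G.matM e f : ℤ[X][X]) : ℤ[X]⟦X⟧) =
    (1 : Matrix E E ℤ[X]⟦X⟧) e f - tS * ((if G.tgt e = G.src f then 1 else 0) -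
      (1 - uS) * if G.inv e = f then 1 else 0) := by
  simp only [matM, overPoly, edgeAdj, inversion, uP, tP, uS, tS, Matrix.sub_apply,
    Matrix.smul_apply, Matrix.map_apply, Matrix.of_apply, Matrix.one_apply, smul_eq_mul]
  split_ifs <;> simp <;> ring

variable [Fintype E]

theorem coe_det_matM : (G.matM.det : ℤ[X]⟦X⟧) = G.bumpMatrix.oneSubX.det := by
  have h := RingHom.map_det (Polynomial.coeToPowerSeries.ringHom (R := ℤ[X])) G.matM
  rw [Polynomial.coeToPowerSeries.ringHom_apply] at h
  rw [h]
  congr 1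
  ext1 e f
  rw [RingHom.mapMatrix_apply, Matrix.map_apply, Polynomial.coeToPowerSeries.ringHom_apply,
    coe_matM_apply]
  simp only [Matrix.oneSubX, bumpMatrix, uS, tS, Matrix.sub_apply, Matrix.smul_apply,
    Matrix.map_apply, Matrix.of_apply, smul_eq_mul]
  split_ifs <;> simp

variable [Fintype V]

theorem exists_coe_det_matM : ∃ m : ℕ, 2 * m = G.numNonSelfInverse ∧
    (G.matM.det : ℤ[X]⟦X⟧) * (1 - (1 - uS) ^ 2 * tS ^ 2) ^ Fintype.card V =
      (1 + (1 - uS) * tS) ^ G.numSelfInverse * (1 - (1 - uS) ^ 2 * tS ^ 2) ^ m *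
        (G.matP.det : ℤ[X]⟦X⟧) := by
  have hinv : Function.Involutive G.inv := G.inv_inv
  obtain ⟨m, hm, hdet⟩ := hinv.exists_det (R := ℤ[X]⟦X⟧)
  refine ⟨m, hm, ?_⟩
  let J : Matrix E E ℤ[X]⟦X⟧ := Matrix.of fun e f => if G.inv e = f then 1 else 0
  let T : Matrix E V ℤ[X]⟦X⟧ := Matrix.of fun e v => if G.tgt e = v then 1 else 0
  let S : Matrix V E ℤ[X]⟦X⟧ := Matrix.of fun v e => if G.src e = v then 1 else 0
  let s : ℤ[X]⟦X⟧ := (1 - uS) * tS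
  have hd : 1 - (1 - uS) ^ 2 * tS ^ 2 = 1 - s ^ 2 := by rw [mul_pow]
  -- Inversion exchanges targets and sources, so JT is the transpose of S and SJT is the degree
  -- matrix.
  have hJT : J * T = Matrix.of fun e v => if G.src e = v then 1 else 0 := by
    ext1 e v
    rw [Matrix.mul_apply, Finset.sum_eq_single (G.inv e)]
    · simp [J, T, tgt_inv]
    · exact fun f _ hf => by simp [J, hf.symm]
    · simp
  have hJJ : J * J = 1 := by
    ext1 e f
    rw [Matrix.mul_apply, Finset.sum_eq_single (G.inv e)]
    · simp [J, G.inv_inv, Matrix.one_apply]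
    · exact fun f _ hf => by simp [J, hf.symm]
    · simp
  have hKL : (1 + s • J) * (1 - s • J) = (1 - s ^ 2) • 1 := by
    rw [mul_sub, mul_one, add_mul, one_mul, Matrix.smul_mul, Matrix.mul_smul, hJJ, smul_smul,
      sub_smul, one_smul, pow_two]
    abel
  have hM : (Polynomial.coeToPowerSeries.ringHom (R := ℤ[X])).mapMatrix G.matM =
      (1 + s • J) - (tS • T) * S := by
    ext1 e f
    rw [RingHom.mapMatrix_apply, Matrix.map_apply, Polynomial.coeToPowerSeries.ringHom_apply,
      coe_matM_apply, Matrix.smul_mul]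
    have : (T * S) e f = if G.tgt e = G.src f then 1 else 0 := by
      simp [T, S, Matrix.mul_apply, eq_comm]
    simp only [Matrix.sub_apply, Matrix.add_apply, Matrix.smul_apply, this, smul_eq_mul, J,
      Matrix.of_apply, s]
    ring
  have hP : (Polynomial.coeToPowerSeries.ringHom (R := ℤ[X])).mapMatrix G.matP =
      (1 - s ^ 2) • 1 - S * (1 - s • J) * (tS • T) := by
    have hA : ∀ v w, (S * T) v w = ((G.vertexAdj v w : ℤ) : ℤ[X]⟦X⟧) := by
      intro v w
      simp [S, T, vertexAdj, Matrix.mul_apply, Finset.sum_ite, Finset.filter_filter, and_comm]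
    have hD : ∀ v w, (S * (J * T)) v w = ((G.degreeMatrix v w : ℤ) : ℤ[X]⟦X⟧) := by
      intro v w
      rw [hJT]
      rcases eq_or_ne v w with rfl | hvw
      · simp [S, degreeMatrix, degree, Matrix.mul_apply, Finset.sum_ite, Finset.filter_filter]
      · rw [degreeMatrix, Matrix.diagonal_apply_ne _ hvw, Int.cast_zero, Matrix.mul_apply]
        refine Finset.sum_eq_zero fun e _ => ?_
        simp only [S, Matrix.of_apply]
        split_ifs with h1 h2 <;> simp
        exact hvw (h1.symm.trans h2)
    ext1 v w
    rw [Matrix.mul_sub, Matrix.mul_one, Matrix.sub_mul, Matrix.mul_smul, Matrix.mul_smul,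
      Matrix.mul_smul, Matrix.smul_mul, Matrix.mul_assoc]
    simp only [matP, overPoly, uP, tP, RingHom.mapMatrix_apply, Matrix.map_apply,
      Matrix.sub_apply, Matrix.add_apply, Matrix.smul_apply, smul_eq_mul, hA, hD, map_sub, map_add,
      map_mul, map_pow, map_one, eq_intCast, map_intCast,
      Polynomial.coeToPowerSeries.ringHom_apply, Polynomial.coe_C, Polynomial.coe_X]
    have h1 : (((1 : Matrix V V ℤ[X][X]) v w : ℤ[X][X]) : ℤ[X]⟦X⟧) =
        (1 : Matrix V V ℤ[X]⟦X⟧) v w := by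
      simp only [Matrix.one_apply]; split_ifs <;> simp
    rw [h1]
    simp only [s, uS, tS]
    ring
  have h1 := RingHom.map_det (Polynomial.coeToPowerSeries.ringHom (R := ℤ[X])) G.matM
  have h2 := RingHom.map_det (Polynomial.coeToPowerSeries.ringHom (R := ℤ[X])) G.matP
  rw [Polynomial.coeToPowerSeries.ringHom_apply] at h1 h2
  rw [h1, h2, hM, hP, hd, Matrix.det_sub_mul_of_mul_eq_smul (hd ▸ isUnit_one_sub_sq) hKL, hdet s]
  rfl

end InvGraph

theorem mainTheorem4 {V E : Type*} [Fintype V] [DecidableEq V] [Fintype E] [DecidableEq E]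
    (G : InvGraph V E) (C : Set G.Circuit) (hC : G.IsPrimitiveRepresentatives C) :
    -- the factors are invertible, the infinite product converges, and its value does not depend
    -- on the choice of representatives
    (∀ c ∈ C, IsUnit (1 - InvGraph.uS ^ c.cyclicBumpCount * InvGraph.tS ^ c.length)) ∧
    Multipliable (fun c : C => InvGraph.zetaFactor c.val) ∧
    (∀ C' : Set G.Circuit, G.IsPrimitiveRepresentatives C' → G.zeta C' = G.zeta C) ∧
    -- the inverse of the zeta function exists and is a polynomial in `u` and `t`
    IsUnit (G.zeta C) ∧
    (∃ Z : Polynomial (Polynomial ℤ),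
      Ring.inverse (G.zeta C) = (Z : PowerSeries (Polynomial ℤ))) ∧
    -- the first determinant formula
    Ring.inverse (G.zeta C) = (G.matM.det : PowerSeries (Polynomial ℤ)) ∧
    -- the second determinant formula
    ∃ m : ℕ, 2 * m = G.numNonSelfInverse ∧
      Ring.inverse (G.zeta C) =
        (1 + (1 - InvGraph.uS) * InvGraph.tS) ^ G.numSelfInverse *
          ((InvGraph.oneSubSqUnit ^ ((m : ℤ) - (Fintype.card V : ℤ)) :
            (PowerSeries (Polynomial ℤ))ˣ) : PowerSeries (Polynomial ℤ)) *
          (G.matP.det : PowerSeries (Polynomial ℤ)) := by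
  have hzeta : ∀ C' : Set G.Circuit, G.IsPrimitiveRepresentatives C' →
      G.zeta C' = Ring.inverse (G.matM.det : PowerSeries (Polynomial ℤ)) := fun C' hC' => by
    rw [G.coe_det_matM]
    exact hC'.hasProd_zetaFactor.tprod_eq
  have hF : IsUnit (G.matM.det : PowerSeries (Polynomial ℤ)) := by
    rw [G.coe_det_matM, PowerSeries.isUnit_iff_constantCoeff, Matrix.constantCoeff_det_oneSubX]
    exact isUnit_one
  have hinv : Ring.inverse (G.zeta C) = (G.matM.det : PowerSeries (Polynomial ℤ)) := by
    rw [hzeta C hC]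
    obtain ⟨F, hF⟩ := hF
    rw [← hF, Ring.inverse_unit, Ring.inverse_unit, inv_inv]
  refine ⟨fun c hc => hC.isUnit_factor ⟨c, hc⟩, hC.hasProd_zetaFactor.multipliable,
    fun C' hC' => by rw [hzeta C' hC', hzeta C hC], ?_, ⟨_, hinv⟩, hinv, ?_⟩
  · rw [hzeta C hC]; exact hF.ringInverse
  · obtain ⟨m, hm, h⟩ := G.exists_coe_det_matM
    refine ⟨m, hm, ?_⟩
    have hu : (InvGraph.oneSubSqUnit : PowerSeries (Polynomial ℤ)) =
        1 - (1 - InvGraph.uS) ^ 2 * InvGraph.tS ^ 2 := rfl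
    rw [← hu] at h
    -- The possibly negative power is cleared by moving the unit's |V|-th power to the other side.
    rw [hinv, zpow_sub, zpow_natCast, zpow_natCast, Units.val_mul, ← mul_assoc, mul_right_comm,
      Units.eq_mul_inv_iff_mul_eq, Units.val_pow_eq_pow_val, Units.val_pow_eq_pow_val, h]
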